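/- Let $(X,d)$ be a complete doubling metric space (there is $n\in\mathbb N$ such that every ball of radius $r>0$ can be covered by at most $n$ balls of radius $r/2$), and let $\mu$ be a Borel measure on $X$ such that $(X,d,\mu)$ carries a measurable differentiable structure $\{(X_\alpha,\varphi_\alpha)\}_{\alpha\in I}$, that is: $I$ is countable; the sets $X_\alpha$ are measurable, of positive measure, pairwise disjoint, and cover $X$ up to a $\mu$-null set; $\varphi_\alpha=(\varphi^\alpha_1,\dots,\varphi^\alpha_{N(\alpha)})$ is a tuple of Lipschitz functions $X\to\mathbb R$ with $\sup_\alpha N(\alpha)<\infty$; and every Lipschitz function $f\colon X\to\mathbb R$ is differentiable almost everywhere in $X$. Here a Bochner measurable map $f$ from $X$ to a Banach space $V$ is *differentiable almost everywhere in* a measurable set $S\subseteq X$ if there are measurable functions $\frac{\partial f}{\partial\varphi^\alpha_n}\colon S\cap X_\alpha\to V$ such that for every $\alpha$ and $\mu$-almost every $x_0\in S\cap X_\alpha$ $$\lim_{\substack{x\to x_0\\ x\in X_\alpha\setminus\{x_0\}}}\frac{\bigl\|f(x)-f(x_0)-\sum_{n=1}^{N(\alpha)}(\varphi^\alpha_n(x)-\varphi^\alpha_n(x_0))\frac{\partial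 f}{\partial\varphi^\alpha_n}(x_0)\bigr\|}{d(x,x_0)}=0,\qquad(*)$$ and if these functions are determined by this condition up to null sets. Let $V$ be a real Banach space, let $\iota\colon X\to V$ be a topological embedding, and let $C\subseteq X$ be a closed set such that $\iota|_C$ is $A$-bi-Lipschitz for some $A\ge 1$. Assume that $\iota$ is differentiable almost everywhere in $C$, with differentials $\frac{\partial\iota}{\partial\varphi^\alpha_n}\colon C\cap X_\alpha\to V$. Let $x_0\in C\cap X_\alpha$ be a point at which $(*)$ holds for $f=\iota$, and at which $C\cap X_\alpha$ is metrically dense in $C$: for every $\varepsilon>0$ there is $r>0$ such that for every $y\in C$ with $d(y,x_0)<r$ there is $x\in C\cap X_\alpha$ with $d(x,y)\le\varepsilon\, d(y,x_0)$. (When $\mu$ is doubling, this is the case at every density point of $C\cap X_\alpha$, hence at almost every point of $C\cap X_\alpha$.) Let $(T,\rho,t_0)$ be a weak tangent to $\iota(C)$ at $\iota(x_0)$. This means that $(T,\rho,t_0)$ is the limit of the pointed metric spaces $(\iota(C),\|\cdot\|_V/r_j,\iota(x_0))$ for some sequence of scales $r_j>0$ with $r_j\to0$, in the following sense: there are $M\in\mathbb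 N$, $\beta\in(0,1]$, $L\ge1$ and maps $g_j\colon\iota(C)\to\mathbb R^M$, $g\colon T\to\mathbb R^M$ with $g_j(\iota(x_0))=0=g(t_0)$, which are $(\beta,L)$-bi-Hölder for the metrics $\|\cdot\|_V/r_j$ and $\rho$ respectively (a map $h$ is $(\beta,L)$-bi-Hölder if $L^{-1}d(p,q)^\beta\le\|h(p)-h(q)\|\le L\,d(p,q)^\beta$ for all $p,q$), such that the sets $F_j=g_j(\iota(C))$ and $F=g(T)$ are closed, for every $r>0$ both $\sup\{\operatorname{dist}(x,F):x\in F_j\cap B(0,r)\}$ and $\sup\{\operatorname{dist}(x,F_j):x\in F\cap B(0,r)\}$ tend to $0$ as $j\to\infty$ (with $\sup\emptyset=0$), and $\|p_j-q_j\|_V/r_j\to\rho(a,b)$ whenever $p_j,q_j\in\iota(C)$ and $a,b\in T$ satisfy $g_j(p_j)\to g(a)$ and $g_j(q_j)\to g(b)$. Then $(T,\rho)$ embeds isometrically into the finite-dimensional subspace $$F_{x_0}=\operatorname{span}\Bigl\{\tfrac{\partial\iota}{\partial\varphi^\alpha_n}(x_0): n=1,\dots,N(\alpha)\Bigr\}\subseteq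 V$$ (with the norm of $V$). -/

import Mathlib

open Set Filter Topology MeasureTheory
open scoped NNReal ENNReal

/-! ## Doubling metric spaces and bi-Lipschitz maps -/

/-- There is `n` such that every ball of radius `r > 0` is covered by at most `n` balls of
radius `r / 2`. -/
def IsDoublingSpace (X : Type*) [MetricSpace X] : Prop :=
  ∃ n : ℕ, ∀ (x : X) (r : ℝ), 0 < r →
    ∃ s : Finset X, s.card ≤ n ∧ Metric.ball x r ⊆ ⋃ y ∈ s, Metric.ball y (r / 2)

/-- The restriction of `f` to `C` is an `A`-bi-Lipschitz embedding. -/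
def IsBiLipschitzOn {X Y : Type*} [MetricSpace X] [MetricSpace Y] (A : ℝ) (f : X → Y)
    (C : Set X) : Prop :=
  1 ≤ A ∧ ∀ x ∈ C, ∀ y ∈ C,
    dist x y / A ≤ dist (f x) (f y) ∧ dist (f x) (f y) ≤ A * dist x y

/-! ## Measurable differentiable structures -/

section Differentiability

variable {X : Type*} [MetricSpace X]
variable {V : Type*} [NormedAddCommGroup V] [NormedSpace ℝ V]

/-- `f` is differentiable at `x` along the patch `P`, with respect to the coordinates `φ`, with
partial derivatives `v` at `x`:
`‖f y - f x - ∑ₙ (φₙ y - φₙ x) vₙ‖ / d(y, x) → 0` as `y → x`, `y ∈ P \ {x}`. -/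
def HasChartDerivAt (P : Set X) {N : ℕ} (φ : Fin N → X → ℝ) (f : X → V) (v : Fin N → V)
    (x : X) : Prop :=
  Tendsto (fun y => ‖f y - f x - ∑ n, (φ n y - φ n x) • v n‖ / dist y x)
    (𝓝[P \ {x}] x) (𝓝 0)

variable [MeasurableSpace X]

/-- `D` is a collection of functions on the sets `S ∩ P i`, measurable with respect to the
completion of the Borel `σ`-algebra, which are partial derivatives of `f` at almost every point
of `S ∩ P i`, for every patch `P i` with coordinates `φ i`. -/
def IsDerivFamily (μ : Measure X) {I : Type*} (P : I → Set X) {N : I → ℕ}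
    (φ : (i : I) → Fin (N i) → X → ℝ) (S : Set X) (f : X → V)
    (D : (i : I) → Fin (N i) → X → V) : Prop :=
  ∀ i : I,
    (∀ (n : Fin (N i)) (U : Set V), IsOpen U →
      NullMeasurableSet ((S ∩ P i) ∩ D i n ⁻¹' U) μ) ∧
    ∀ᵐ x ∂μ, x ∈ S ∩ P i → HasChartDerivAt (P i) (φ i) f (fun n => D i n x) x

/-- The (Bochner measurable) map `f` is differentiable at almost every point of `S`, with
differentials `D`: these are partial derivatives almost everywhere, and they are determined by
this up to sets of measure zero in `S`. -/
structure IsDifferentialOn (μ : Measure X) {I : Type*} (P : I → Set X) {N : I → ℕ}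
    (φ : (i : I) → Fin (N i) → X → ℝ) (S : Set X) (f : X → V)
    (D : (i : I) → Fin (N i) → X → V) : Prop where
  bochner_measurable : AEStronglyMeasurable f μ
  isDerivFamily : IsDerivFamily μ P φ S f D
  unique : ∀ D' : (i : I) → Fin (N i) → X → V, IsDerivFamily μ P φ S f D' →
    ∀ (i : I) (n : Fin (N i)), ∀ᵐ x ∂μ, x ∈ S ∩ P i → D' i n x = D i n x

/-- A measurable differentiable structure on `(X, d, μ)`, indexed by `I`. -/
structure MeasurableDifferentiableStructure (X : Type*) [MetricSpace X] [MeasurableSpace X]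
    (μ : Measure X) (I : Type*) where
  /-- the patches `X_α` -/
  patch : I → Set X
  /-- the dimensions `N(α)` -/
  dim : I → ℕ
  /-- the coordinates `φ_α` -/
  coord : (i : I) → Fin (dim i) → X → ℝ
  countable_index : Countable I
  measurable_patch : ∀ i, NullMeasurableSet (patch i) μ
  measure_patch_pos : ∀ i, 0 < μ (patch i)
  disjoint_patch : Pairwise fun i j => Disjoint (patch i) (patch j)
  full_measure : μ (⋃ i, patch i)ᶜ = 0
  lipschitz_coord : ∀ i n, ∃ K : ℝ≥0, LipschitzWith K (coord i n)
  dim_bounded : ∃ B : ℕ, ∀ i, dim i ≤ B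
  differentiable : ∀ f : X → ℝ, (∃ K : ℝ≥0, LipschitzWith K f) →
    ∃ D : (i : I) → Fin (dim i) → X → ℝ, IsDifferentialOn μ patch coord univ f D

end Differentiability

/-- `E` is metrically dense in `C` at `x₀`: every point `y ∈ C` near `x₀` is at distance at most
`ε * d(y, x₀)` from `E`. -/
def MetricallyDenseAt {X : Type*} [MetricSpace X] (E C : Set X) (x₀ : X) : Prop :=
  ∀ ε : ℝ, 0 < ε → ∃ r : ℝ, 0 < r ∧
    ∀ y ∈ C ∩ Metric.ball x₀ r, ∃ x ∈ E, dist x y ≤ ε * dist y x₀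

/-! ## Weak tangents -/

/-- Convergence of closed subsets `F j` of `ℝ^M` to a closed subset `F'`: for every `r > 0`,
`sup {dist(x, F') : x ∈ F j ∩ B(0, r)} → 0` and `sup {dist(x, F j) : x ∈ F' ∩ B(0, r)} → 0`. -/
def ClosedSetsConverge {M : ℕ} (F : ℕ → Set (EuclideanSpace ℝ (Fin M)))
    (F' : Set (EuclideanSpace ℝ (Fin M))) : Prop :=
  (∀ j, IsClosed (F j) ∧ (F j).Nonempty) ∧ IsClosed F' ∧ F'.Nonempty ∧
  ∀ r : ℝ, 0 < r →
    Tendsto (fun j => ⨆ x ∈ F j ∩ Metric.ball 0 r, Metric.infEDist x F') atTop (𝓝 0) ∧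
    Tendsto (fun j => ⨆ x ∈ F' ∩ Metric.ball 0 r, Metric.infEDist x (F j)) atTop (𝓝 0)

/-- `g` is `(β, L)`-bi-Hölder for the metric `d_Z / s` on `Z`. -/
def IsBiHolder {Z : Type*} [MetricSpace Z] {M : ℕ} (β L s : ℝ)
    (g : Z → EuclideanSpace ℝ (Fin M)) : Prop :=
  ∀ p q : Z, (dist p q / s) ^ β / L ≤ dist (g p) (g q) ∧
    dist (g p) (g q) ≤ L * (dist p q / s) ^ β

/-- The pointed metric spaces `(Z, d_Z / r j, z₀)` converge to the pointed metric space
`(T, d_T, t₀)`: there are uniformly bi-Hölder, base point preserving maps `g j : Z → ℝ^M` and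
`g' : T → ℝ^M` such that the images `g j (Z)` converge to `g' (T)`, and the functions
`d_Z((g j)⁻¹ ·, (g j)⁻¹ ·) / r j` on `g j (Z) × g j (Z)` converge to `d_T(g'⁻¹ ·, g'⁻¹ ·)`, in the
sense that their values along every sequence of points of `g j (Z) × g j (Z)` which converges in
`ℝ^M × ℝ^M` (necessarily to a point of `g' (T) × g' (T)`) converge to the value at the limit. -/
def RescalingsConverge (Z : Type*) [MetricSpace Z] (z₀ : Z) (r : ℕ → ℝ)
    (T : Type*) [MetricSpace T] (t₀ : T) : Prop :=
  ∃ (M : ℕ) (β L : ℝ) (g : ℕ → Z → EuclideanSpace ℝ (Fin M)) (g' : T → EuclideanSpace ℝ (Fin M)),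
    0 < β ∧ β ≤ 1 ∧ 1 ≤ L ∧
    (∀ j, IsBiHolder β L (r j) (g j)) ∧ IsBiHolder β L 1 g' ∧
    (∀ j, g j z₀ = 0) ∧ g' t₀ = 0 ∧
    ClosedSetsConverge (fun j => range (g j)) (range g') ∧
    ∀ (p q : ℕ → Z) (a b : T),
      Tendsto (fun j => g j (p j)) atTop (𝓝 (g' a)) →
      Tendsto (fun j => g j (q j)) atTop (𝓝 (g' b)) →
      Tendsto (fun j => dist (p j) (q j) / r j) atTop (𝓝 (dist a b))

/-- `(T, t₀)` is a weak tangent to the metric space `Z` at `z₀`: the limit of the pointed metric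
spaces `(Z, d_Z / r j, z₀)` for some sequence of scales `r j > 0` tending to zero. -/
def IsWeakTangent (Z : Type*) [MetricSpace Z] (z₀ : Z) (T : Type*) [MetricSpace T] (t₀ : T) :
    Prop :=
  ∃ r : ℕ → ℝ, (∀ j, 0 < r j) ∧ Tendsto r atTop (𝓝 0) ∧ RescalingsConverge Z z₀ r T t₀

/-!
Near `x₀` the increments `ι y - ι x₀`, `y ∈ C`, lie within `o(d(y, x₀))` of the span `F` of the
partial derivatives: for `y` in the patch this is differentiability, and metric density together
with the Lipschitz bound carries it over to all of `C` (`infDist_sub_span_le`).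

A point `a` of the weak tangent is represented by a sequence `p j ∈ ι(C)` whose images converge in
`ℝ^M` (`RescalingsConverge.exists_approximants`). The vectors `(p j - ι x₀) / r j` are bounded,
their mutual distances converge to those of `T`, and by the first step they approach `F`. Since `F`
is finite-dimensional, they have limits in `F` along a nonprincipal ultrafilter on `ℕ`. The
ultrafilter selects limits for all points of `T` at once, so neither separability of `T` nor a
diagonal argument is needed, and the resulting map `T → F` is an isometry
(`exists_isometry_of_tendsto_dist`).
-/

theorem exists_seq_mem_tendsto_dist {E : Type*} [PseudoMetricSpace E] {u : ℕ → E}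
    {S : ℕ → Set E} (hS : ∀ j, (S j).Nonempty)
    (h : Tendsto (fun j => Metric.infDist (u j) (S j)) atTop (𝓝 0)) :
    ∃ y : ℕ → E, (∀ j, y j ∈ S j) ∧ Tendsto (fun j => dist (u j) (y j)) atTop (𝓝 0) := by
  have key : ∀ j : ℕ, ∃ y ∈ S j,
      dist (u j) y < Metric.infDist (u j) (S j) + 1 / ((j : ℝ) + 1) := fun j =>
    (Metric.infDist_lt_iff (hS j)).1 (lt_add_of_pos_right _ (by positivity))
  choose y hy hlt using key
  refine ⟨y, hy, squeeze_zero (fun _ => dist_nonneg) (fun j => (hlt j).le) ?_⟩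
  simpa using h.add (tendsto_one_div_add_atTop_nhds_zero_nat (𝕜 := ℝ))

/-- If rescaled pictures `u j` of `T` in a normed space become isometric and approach a
finite-dimensional subspace `F`, then `T` embeds isometrically into `F`. -/
theorem exists_isometry_of_tendsto_dist {T V : Type*} [MetricSpace T] [NormedAddCommGroup V]
    [NormedSpace ℝ V] (F : Submodule ℝ V) [FiniteDimensional ℝ F] (u : T → ℕ → V)
    (hbdd : ∀ a, ∃ R : ℝ, ∀ᶠ j in atTop, ‖u a j‖ ≤ R)
    (hdist : ∀ a b, Tendsto (fun j => dist (u a j) (u b j)) atTop (𝓝 (dist a b)))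
    (hF : ∀ a, Tendsto (fun j => Metric.infDist (u a j) F) atTop (𝓝 0)) :
    ∃ G : T → F, Isometry G := by
  have : ProperSpace F := FiniteDimensional.proper ℝ F
  choose w hwF hw using fun a =>
    exists_seq_mem_tendsto_dist (S := fun _ => (F : Set V)) (fun _ => ⟨0, F.zero_mem⟩) (hF a)
  let w' : T → ℕ → F := fun a j => ⟨w a j, hwF a j⟩
  have hlim : ∀ a, ∃ x : F, Tendsto (w' a) (hyperfilter ℕ : Filter ℕ) (𝓝 x) := by
    intro a
    obtain ⟨R, hR⟩ := hbdd a
    have hmem : ∀ᶠ j in atTop, w' a j ∈ Metric.closedBall (0 : F) (R + 1) := by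
      filter_upwards [hR, (hw a).eventually_le_const one_pos] with j h1 h2
      rw [mem_closedBall_zero_iff]
      change ‖w a j‖ ≤ R + 1
      have h3 := norm_le_norm_add_norm_sub (u a j) (w a j)
      rw [dist_eq_norm] at h2
      linarith
    have hle : (hyperfilter ℕ : Filter ℕ) ≤ atTop := Nat.hyperfilter_le_atTop
    obtain ⟨x, -, hx⟩ := (isCompact_closedBall (0 : F) (R + 1)).ultrafilter_le_nhds
      ((hyperfilter ℕ).map (w' a)) (le_principal_iff.2 (hle hmem))
    exact ⟨x, hx⟩
  choose G hG using hlim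
  refine ⟨G, Isometry.of_dist_eq fun a b => ?_⟩
  have h1 : Tendsto (fun j => dist (w a j) (w b j)) atTop (𝓝 (dist a b)) := by
    refine (hdist a b).congr_dist ?_
    refine squeeze_zero (fun _ => dist_nonneg) (fun j => dist_dist_dist_le _ _ _ _) ?_
    simpa using (hw a).add (hw b)
  exact tendsto_nhds_unique ((hG a).dist (hG b)) (h1.mono_left Nat.hyperfilter_le_atTop)

theorem HasChartDerivAt.eventually_norm_sub_le {X V : Type*} [MetricSpace X]
    [NormedAddCommGroup V] [NormedSpace ℝ V] {P : Set X} {N : ℕ} {φ : Fin N → X → ℝ} {f : X → V}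
    {v : Fin N → V} {x : X} (h : HasChartDerivAt P φ f v x) {c : ℝ} (hc : 0 < c) :
    ∀ᶠ y in 𝓝 x, y ∈ P →
      ‖f y - f x - ∑ n, (φ n y - φ n x) • v n‖ ≤ c * dist y x := by
  filter_upwards [eventually_nhdsWithin_iff.1 (h.eventually_le_const hc)] with y hy hyP
  rcases eq_or_ne y x with rfl | hne
  · simp
  · exact (div_le_iff₀ (dist_pos.2 hne)).1 (hy ⟨hyP, hne⟩)

/-- The increments of `f` along `C` lie within `o(d(y, x₀))` of the span of the partial
derivatives, also at points outside the patch. -/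
theorem infDist_sub_span_le {X V : Type*} [MetricSpace X] [NormedAddCommGroup V]
    [NormedSpace ℝ V] {C P : Set X} {N : ℕ} {φ : Fin N → X → ℝ} {f : X → V} {v : Fin N → V}
    {x₀ : X} {A : ℝ} (hA : IsBiLipschitzOn A f C) (hdense : MetricallyDenseAt (C ∩ P) C x₀)
    (hdiff : HasChartDerivAt P φ f v x₀) {ε : ℝ} (hε : 0 < ε) :
    ∀ᶠ y in 𝓝 x₀, y ∈ C →
      Metric.infDist (f y - f x₀) (Submodule.span ℝ (range v)) ≤ ε * dist y x₀ := by
  have hA0 : 0 < A := one_pos.trans_le hA.1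
  -- The approximating point `x` of the patch satisfies `d(x, x₀) ≤ 2 d(y, x₀)` because `δ ≤ 1`;
  -- replacing `y` by `x` costs `A δ d(y, x₀) ≤ (ε / 2) d(y, x₀)`.
  set δ := min 1 (ε / (2 * A))
  have hδ0 : 0 < δ := lt_min one_pos (by positivity)
  have hδ1 : δ ≤ 1 := min_le_left _ _
  have hAδ : A * δ ≤ ε / 2 := by
    calc A * δ ≤ A * (ε / (2 * A)) := by gcongr; exact min_le_right _ _
      _ = ε / 2 := by field_simp
  obtain ⟨r, hr, hdr⟩ := hdense δ hδ0
  obtain ⟨s, hs, hds⟩ := Metric.eventually_nhds_iff.1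
    (hdiff.eventually_norm_sub_le (c := ε / 4) (by positivity))
  refine Metric.eventually_nhds_iff.2 ⟨min r (s / 2), lt_min hr (by positivity), ?_⟩
  intro y hy hyC
  obtain ⟨x, hx, hxy⟩ := hdr y ⟨hyC, hy.trans_le (min_le_left _ _)⟩
  have hxx₀ : dist x x₀ ≤ 2 * dist y x₀ := by
    have h1 := dist_triangle x y x₀
    have h2 : δ * dist y x₀ ≤ 1 * dist y x₀ := by gcongr
    linarith
  have hys : dist y x₀ < s / 2 := hy.trans_le (min_le_right _ _)
  have hdx := hds (by linarith : dist x x₀ < s) hx.2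
  have hw : ∑ n, (φ n x - φ n x₀) • v n ∈ Submodule.span ℝ (range v) :=
    Submodule.sum_mem _ fun n _ =>
      Submodule.smul_mem _ _ (Submodule.subset_span (mem_range_self n))
  have hxy' : ‖f y - f x‖ ≤ A * (δ * dist y x₀) := by
    rw [← dist_eq_norm]
    refine ((hA.2 y hyC x hx.1).2).trans ?_
    rw [dist_comm y x]
    gcongr
  calc Metric.infDist (f y - f x₀) (Submodule.span ℝ (range v))
      ≤ dist (f y - f x₀) (∑ n, (φ n x - φ n x₀) • v n) := Metric.infDist_le_dist_of_mem hw
    _ = ‖(f y - f x) + (f x - f x₀ - ∑ n, (φ n x - φ n x₀) • v n)‖ := by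
        rw [dist_eq_norm]; congr 1; abel
    _ ≤ A * (δ * dist y x₀) + ε / 4 * dist x x₀ := (norm_add_le _ _).trans (add_le_add hxy' hdx)
    _ ≤ ε / 2 * dist y x₀ + ε / 4 * (2 * dist y x₀) := by
        rw [← mul_assoc]; gcongr
    _ = ε * dist y x₀ := by ring

/-- Every point of the limit is represented by a sequence in the rescaled spaces, and distances
between representing sequences, and to the base point, converge. -/
theorem RescalingsConverge.exists_approximants {Z T : Type*} [MetricSpace Z] [MetricSpace T]
    {z₀ : Z} {r : ℕ → ℝ} {t₀ : T} (h : RescalingsConverge Z z₀ r T t₀) :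
    ∃ p : T → ℕ → Z,
      (∀ a b, Tendsto (fun j => dist (p a j) (p b j) / r j) atTop (𝓝 (dist a b))) ∧
      ∀ a, Tendsto (fun j => dist (p a j) z₀ / r j) atTop (𝓝 (dist a t₀)) := by
  obtain ⟨M, β, L, g, g', -, -, -, -, -, hg0, hg'0, ⟨hne, -, -, hconv⟩, hd⟩ := h
  have hp : ∀ a : T, ∃ p : ℕ → Z, Tendsto (fun j => g j (p j)) atTop (𝓝 (g' a)) := by
    intro a
    have hsup := (hconv (‖g' a‖ + 1) (by positivity)).2
    have hE : Tendsto (fun j => Metric.infEDist (g' a) (range (g j))) atTop (𝓝 0) :=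
      tendsto_of_tendsto_of_tendsto_of_le_of_le tendsto_const_nhds hsup (fun _ => zero_le)
        fun j => le_iSup₂_of_le (g' a) ⟨mem_range_self a, by simp⟩ le_rfl
    have hinf : Tendsto (fun j => Metric.infDist (g' a) (range (g j))) atTop (𝓝 0) := by
      rw [← ENNReal.toReal_zero]
      exact (ENNReal.tendsto_toReal ENNReal.zero_ne_top).comp hE
    obtain ⟨y, hy, hlim⟩ := exists_seq_mem_tendsto_dist (fun j => (hne j).2) hinf
    choose p hp using hy
    refine ⟨p, ?_⟩
    simp only [hp]
    exact tendsto_iff_dist_tendsto_zero.2 (by simpa only [dist_comm] using hlim)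
  choose p hp using hp
  refine ⟨p, fun a b => hd _ _ a b (hp a) (hp b), fun a => hd _ (fun _ => z₀) a t₀ (hp a) ?_⟩
  simp [hg0, hg'0]

theorem Submodule.infDist_smul_le {V : Type*} [NormedAddCommGroup V] [NormedSpace ℝ V]
    (F : Submodule ℝ V) {c : ℝ} (hc : 0 < c) (v : V) :
    Metric.infDist (c • v) F ≤ c * Metric.infDist v F := by
  rw [← div_le_iff₀' hc, Metric.le_infDist ⟨0, F.zero_mem⟩]
  intro w hw
  rw [div_le_iff₀' hc]
  refine (Metric.infDist_le_dist_of_mem (F.smul_mem c hw)).trans_eq ?_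
  rw [dist_smul₀, Real.norm_of_nonneg hc.le]

theorem mainTheorem7
    {X : Type*} [MetricSpace X] [CompleteSpace X] (hX : IsDoublingSpace X)
    [MeasurableSpace X] [BorelSpace X] (μ : Measure X)
    {I : Type*} (𝒟 : MeasurableDifferentiableStructure X μ I)
    {V : Type*} [NormedAddCommGroup V] [NormedSpace ℝ V] [CompleteSpace V]
    (ι : X → V) (hι : IsEmbedding ι)
    (C : Set X) (hC : IsClosed C)
    (A : ℝ) (hA : IsBiLipschitzOn A ι C)
    (D : (α : I) → Fin (𝒟.dim α) → X → V)
    (hD : IsDifferentialOn μ 𝒟.patch 𝒟.coord C ι D)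
    (α : I) (x₀ : X) (hx₀ : x₀ ∈ C ∩ 𝒟.patch α)
    (hdense : MetricallyDenseAt (C ∩ 𝒟.patch α) C x₀)
    (hdiff : HasChartDerivAt (𝒟.patch α) (𝒟.coord α) ι (fun n => D α n x₀) x₀)
    {T : Type*} [MetricSpace T] (t₀ : T)
    (hT : IsWeakTangent (ι '' C) ⟨ι x₀, mem_image_of_mem ι hx₀.1⟩ T t₀) :
    ∃ G : T → Submodule.span ℝ (range fun n => D α n x₀), Isometry G := by
  obtain ⟨r, hr, hr0, hconv⟩ := hT
  obtain ⟨p, hpd, hp0⟩ := hconv.exists_approximants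
  choose q hqC hq using fun a j => (p a j).2
  have hA0 : 0 < A := one_pos.trans_le hA.1
  replace hpd : ∀ a b, Tendsto (fun j => dist (ι (q a j)) (ι (q b j)) / r j) atTop
      (𝓝 (dist a b)) := by
    simpa only [Subtype.dist_eq, ← hq] using hpd
  replace hp0 : ∀ a, Tendsto (fun j => dist (ι (q a j)) (ι x₀) / r j) atTop
      (𝓝 (dist a t₀)) := by
    simpa only [Subtype.dist_eq, ← hq] using hp0
  -- The constant is any number larger than the limit `dist a t₀` of the rescaled distances.
  have hR : ∀ a, ∀ᶠ j in atTop, dist (ι (q a j)) (ι x₀) / r j ≤ dist a t₀ + 1 := fun a =>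
    (hp0 a).eventually_le_const (lt_add_one _)
  have hqR : ∀ a, ∀ᶠ j in atTop, dist (q a j) x₀ ≤ A * (dist a t₀ + 1) * r j := by
    intro a
    filter_upwards [hR a] with j hj
    have h1 := (hA.2 (q a j) (hqC a j) x₀ hx₀.1).1
    rw [div_le_iff₀ (hr j)] at hj
    rw [div_le_iff₀' hA0] at h1
    rw [mul_assoc]
    exact h1.trans (by gcongr)
  have hq0 : ∀ a, Tendsto (q a) atTop (𝓝 x₀) := fun a =>
    tendsto_iff_dist_tendsto_zero.2 <|
      squeeze_zero' (.of_forall fun _ => dist_nonneg) (hqR a) (by simpa using hr0.const_mul _)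
  have : FiniteDimensional ℝ (Submodule.span ℝ (range fun n => D α n x₀)) :=
    FiniteDimensional.span_of_finite ℝ (finite_range _)
  refine exists_isometry_of_tendsto_dist _ (fun a j => (r j)⁻¹ • (ι (q a j) - ι x₀)) ?_ ?_ ?_
  · intro a
    refine ⟨dist a t₀ + 1, (hR a).mono fun j hj => ?_⟩
    rwa [norm_smul, norm_inv, Real.norm_of_nonneg (hr j).le, ← dist_eq_norm, inv_mul_eq_div]
  · intro a b
    refine (hpd a b).congr fun j => ?_
    rw [dist_smul₀, norm_inv, Real.norm_of_nonneg (hr j).le, dist_sub_right, inv_mul_eq_div]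
  · intro a
    have hK : 0 < A * (dist a t₀ + 1) := by positivity
    rw [Metric.tendsto_nhds]
    intro ε hε
    have hnear := (hq0 a).eventually (infDist_sub_span_le hA hdense hdiff
      (ε := ε / 2 / (A * (dist a t₀ + 1))) (by positivity))
    filter_upwards [hnear, hqR a] with j h1 h2
    rw [Real.dist_0_eq_abs, abs_of_nonneg Metric.infDist_nonneg]
    have hrj := hr j
    calc _ ≤ (r j)⁻¹ * _ := Submodule.infDist_smul_le _ (inv_pos.2 hrj) _
      _ ≤ (r j)⁻¹ * (ε / 2 / (A * (dist a t₀ + 1)) * (A * (dist a t₀ + 1) * r j)) := by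
        gcongr
        exact (h1 (hqC a j)).trans (by gcongr)
      _ = ε / 2 := by field_simp
      _ < ε := half_lt_self hε
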